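/- Let $T$ be a planar tangle diagram in a disc, consisting of $N$ properly embedded arcs (with endpoints on the boundary circle, and without closed components), endowed with an orientation. Suppose that $T$ is *simple*: every arc of $T$ is *pure*, i.e. at every point of the arc, each of the two sides of the arc can be connected to the boundary of the disc by a path that does not cross $T$. Let $n_+$ and $n_-$ be the numbers of right-handed and left-handed crossings of $T$. Let $\mathbb K$ be a field and let $H^{k,q}(T)$ be the Khovanov cohomology of $T$ over $\mathbb K$ in homological degree $k$ and quantum degree $q$. It is the cohomology of the complex built from the cube of smoothings of $T$ in which a circle contributes $V=\mathbb K v_+\oplus\mathbb K v_-$ with $\deg v_\pm=\pm1$, an arc contributes $W=\mathbb K w$ with $\deg w=-1$, and a saddle acts by - $v_+\otimes v_+\mapsto v_+$, $v_+\otimes v_-\mapsto v_-$, $v_-\otimes v_+\mapsto v_-$, $v_-\otimes v_-\mapsto 0$ when it merges two circles, and $v_+\otimes w\mapsto w$, $v_-\otimes w\mapsto 0$ when it merges a circle into an arc; - $v_+\mapsto v_+\otimes v_-+v_-\otimes v_+$, $v_-\mapsto v_-\otimes v_-$ when it splits a circle, and $w\mapsto w\otimes v_-$ when it splits a circle off an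 arc; - zero when it transforms two arcs into two arcs. The edges of the cube carry the usual signs. A basis element of $\theta$-degree $\theta$ (the sum of the degrees of its tensor factors) at a smoothing with $\ell$ $1$-smoothings has degrees $k=\ell-n_-$ and $q=k+n_+-n_-+\theta$. Then the Poincaré polynomial of $T$ is $$\mathcal P_T(x,y)=\sum_{k,q}\dim_{\mathbb K}H^{k,q}(T)\,x^ky^q=y^{-N+n_++n_-}\,(1+xy)^{n_+}\,(x^{-1}y^{-3}+y^{-2})^{n_-}$$ as a Laurent polynomial in $x$ and $y$. -/

import Mathlib

/-- The set of orbits on `D` of the group generated by a set `S` of permutations of `D`. -/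
abbrev PermOrbits {D : Type} (S : Set (Equiv.Perm D)) : Type :=
  MulAction.orbitRel.Quotient (Subgroup.closure S) D

/-- The orbit of `d` under the group generated by `S`. -/
abbrev permOrbit {D : Type} (S : Set (Equiv.Perm D)) (d : D) : PermOrbits S :=
  Quotient.mk (MulAction.orbitRel (Subgroup.closure S) D) d

/-- A combinatorial map is given by a finite set `D` of darts (half-edges), the rotation `σ` taking
a dart to the counterclockwise next one at the same vertex, and the involution `α` exchanging the
two halves of each edge. Then `σ * α` traverses the face on the right of a dart. The map is drawn on
spheres (one for each connected component) iff `#vertices - #edges + #faces = 2 * #components`. -/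
def IsSphericalMap {D : Type} (σ α : Equiv.Perm D) : Prop :=
  (Nat.card (PermOrbits {σ}) : ℤ) - Nat.card (PermOrbits {α}) + Nat.card (PermOrbits {σ * α})
    = 2 * Nat.card (PermOrbits {σ, α})

namespace TangleDiagram

/-- Darts of a diagram in the disc with `n` crossings and `b` endpoints on the boundary circle. The
four darts `(c, 0), (c, 1), (c, 2), (c, 3)` leave the crossing `c` in counterclockwise order, those
in positions `0, 2` belonging to the lower strand and those in positions `1, 3` to the upper strand.
The darts `Sum.inr p` start at the endpoints, which are numbered clockwise around the circle. -/
abbrev Dart (n b : ℕ) : Type := (Fin n × Fin 4) ⊕ Fin b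

/-- The permutation of the darts which acts by `f c` on the positions at the crossing `c` and by `g`
on the endpoints. -/
def dartPerm {n b : ℕ} (f : Fin n → Equiv.Perm (Fin 4)) (g : Equiv.Perm (Fin b)) :
    Equiv.Perm (Dart n b) :=
  Equiv.sumCongr (Equiv.prodCongrRight f) g

/-- The counterclockwise rotation of darts. The complement of the open disc in the sphere is
contracted to one vertex, which has all the endpoints as its darts (clockwise around the disc is
counterclockwise around this outer vertex). -/
def rotation (n b : ℕ) : Equiv.Perm (Dart n b) :=
  dartPerm (fun _ => finRotate 4) (finRotate b)

/-- Passing straight through each crossing; the darts at the endpoints are fixed. -/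
def straight (n b : ℕ) : Equiv.Perm (Dart n b) :=
  dartPerm (fun _ => Equiv.swap 0 2 * Equiv.swap 1 3) 1

end TangleDiagram

/-- A planar diagram, in a disc, of a tangle consisting of arcs (properly embedded intervals, no
closed components). It is a planar graph with four-valent vertices at the crossings and univalent
vertices at the endpoints on the boundary circle, up to isotopy; `edge` exchanges the two halves of
each edge. -/
structure TangleDiagram where
  /-- the number of crossings -/
  numCrossings : ℕ
  /-- the number of endpoints on the boundary circle -/
  numEndpoints : ℕ
  /-- the gluing of half-edges to edges -/
  edge : Equiv.Perm (TangleDiagram.Dart numCrossings numEndpoints)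
  edge_edge : ∀ d, edge (edge d) = d
  edge_ne : ∀ d, edge d ≠ d
  planar : IsSphericalMap (TangleDiagram.rotation numCrossings numEndpoints) edge
  /-- every strand runs to the boundary, so that there are no closed components -/
  no_closed : ∀ d, ∃ p : Fin numEndpoints,
    permOrbit {edge, TangleDiagram.straight numCrossings numEndpoints} d
      = permOrbit {edge, TangleDiagram.straight numCrossings numEndpoints} (Sum.inr p)

namespace TangleDiagram

/-- The darts of the diagram `T`. -/
abbrev D (T : TangleDiagram) : Type := Dart T.numCrossings T.numEndpoints

/-- The arcs of `T`, as sets of darts: follow edges and pass straight through crossings. -/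
abbrev Arc (T : TangleDiagram) : Type :=
  PermOrbits {T.edge, straight T.numCrossings T.numEndpoints}

/-- The arc on which a dart lies. -/
abbrev arcOf (T : TangleDiagram) (d : T.D) : T.Arc :=
  permOrbit {T.edge, straight T.numCrossings T.numEndpoints} d

/-- The number of arcs. -/
noncomputable def numArcs (T : TangleDiagram) : ℕ := Nat.card T.Arc

/-- The faces of `T` on the sphere with the outside of the disc contracted to a vertex. These are
the connected components of the complement of `T` in the open disc. -/
abbrev Face (T : TangleDiagram) : Type :=
  PermOrbits {rotation T.numCrossings T.numEndpoints * T.edge}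

/-- The face on the right of the dart `d`. -/
abbrev rightFace (T : TangleDiagram) (d : T.D) : T.Face :=
  permOrbit {rotation T.numCrossings T.numEndpoints * T.edge} d

/-- A face reaches the boundary of the disc iff it has a corner at the outer vertex: such a corner
is a piece of the boundary circle between two consecutive endpoints. The points of such a face are
those which can be joined to the boundary circle by a path that avoids `T`. -/
def Face.ReachesBoundary {T : TangleDiagram} (F : T.Face) : Prop :=
  ∃ p : Fin T.numEndpoints, F = T.rightFace (Sum.inr p)

/-- An arc is pure if at each of its points either side of the arc can be connected to the boundary
by a path without crossings. The faces on the two sides of the edge with dart `d` are the face on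
the right of `d` and the face on the right of the reversed dart `T.edge d`. -/
def IsPure (T : TangleDiagram) (a : T.Arc) : Prop :=
  ∀ d : T.D, T.arcOf d = a →
    (T.rightFace d).ReachesBoundary ∧ (T.rightFace (T.edge d)).ReachesBoundary

/-- A tangle diagram is simple if each of its arcs is pure. -/
def IsSimple (T : TangleDiagram) : Prop := ∀ a : T.Arc, T.IsPure a

/-! ### Orientations and signs of crossings -/

/-- An orientation of all arcs: `out d` says that the arc through `d` is oriented away from the
vertex at which the dart `d` starts. -/
structure Orientation (T : TangleDiagram) where
  /-- whether the orientation points along the dart -/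
  out : T.D → Bool
  out_edge : ∀ d, out (T.edge d) = !(out d)
  out_straight : ∀ (c : Fin T.numCrossings) (i : Fin 4),
    out (straight T.numCrossings T.numEndpoints (Sum.inl (c, i))) = !(out (Sum.inl (c, i)))

/-- A crossing is right-handed (positive) if the direction of its lower strand is obtained from the
direction of its upper strand by a counterclockwise quarter turn: then one of the two adjacent darts
`0` (lower) and `1` (upper) is incoming and the other one outgoing. Otherwise it is left-handed. -/
def Orientation.RightHanded {T : TangleDiagram} (o : T.Orientation) (c : Fin T.numCrossings) :
    Prop :=
  o.out (Sum.inl (c, 0)) ≠ o.out (Sum.inl (c, 1))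

/-- The number `n₊` of right-handed crossings. -/
noncomputable def Orientation.nPos {T : TangleDiagram} (o : T.Orientation) : ℕ :=
  Nat.card {c : Fin T.numCrossings // o.RightHanded c}

/-- The number `n₋` of left-handed crossings. -/
noncomputable def Orientation.nNeg {T : TangleDiagram} (o : T.Orientation) : ℕ :=
  Nat.card {c : Fin T.numCrossings // ¬ o.RightHanded c}

/-! ### The Khovanov complex -/

/-- Vertices of the cube of smoothings; `true` stands for the `1`-smoothing. -/
abbrev State (T : TangleDiagram) : Type := Fin T.numCrossings → Bool

/-- The number of `1`-smoothings in a state. -/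
def State.height {T : TangleDiagram} (s : T.State) : ℕ := (Finset.univ.filter (s · = true)).card

/-- How the strands run in a smoothed diagram. The `0`-smoothing of a crossing joins the two regions
swept by the upper strand when it is turned counterclockwise towards the lower one, so it connects
the positions `0 — 1` and `2 — 3`; the `1`-smoothing connects `1 — 2` and `3 — 0`. -/
def smoothing (T : TangleDiagram) (s : T.State) : Equiv.Perm T.D :=
  dartPerm (fun c => if s c then Equiv.swap 1 2 * Equiv.swap 3 0 else Equiv.swap 0 1 * Equiv.swap 2 3)
    1

/-- The components (arcs and circles) of the smoothed diagram. -/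
abbrev Component (T : TangleDiagram) (s : T.State) : Type := PermOrbits {T.edge, T.smoothing s}

/-- The component of the smoothed diagram which contains a given dart. -/
abbrev componentOf (T : TangleDiagram) (s : T.State) (d : T.D) : T.Component s :=
  permOrbit {T.edge, T.smoothing s} d

/-- A component of a smoothed diagram is an arc if it contains an endpoint; otherwise it is a
circle. -/
def Component.IsArc {T : TangleDiagram} {s : T.State} (x : T.Component s) : Prop :=
  ∃ p : Fin T.numEndpoints, x = T.componentOf s (Sum.inr p)

/-- The basis vectors `v₊`, `v₋` of the space `V` attached to a circle, and the basis vector `w` of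
the one-dimensional space `W` attached to an arc. -/
inductive Label
  | plus
  | minus
  | w
  deriving DecidableEq

/-- The degrees: `deg v₊ = 1`, `deg v₋ = -1`, `deg w = -1`. -/
def Label.degree : Label → ℤ
  | .plus => 1
  | .minus => -1
  | .w => -1

/-- `Merges a b c`: the basis vector `c` occurs (with coefficient one) in the image of `a ⊗ b` under
the map of a saddle which merges two components. These maps are `V ⊗ V → V`, sending
`v₊ ⊗ v₊ ↦ v₊`, `v₊ ⊗ v₋ ↦ v₋`, `v₋ ⊗ v₊ ↦ v₋`, `v₋ ⊗ v₋ ↦ 0`, and `V ⊗ W → W`, sending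
`v₊ ⊗ w ↦ w`, `v₋ ⊗ w ↦ 0`, and the same for `W ⊗ V → W`. -/
def Merges : Label → Label → Label → Prop
  | .plus, b, c => c = b
  | a, .plus, c => c = a
  | _, _, _ => False

/-- `Splits a b c`: the basis vector `b ⊗ c` occurs (with coefficient one) in the image of `a` under
the map of a saddle which splits a component into two. These maps are `V → V ⊗ V`, sending
`v₊ ↦ v₊ ⊗ v₋ + v₋ ⊗ v₊`, `v₋ ↦ v₋ ⊗ v₋`, and `W → W ⊗ V`, sending `w ↦ w ⊗ v₋`, and the same for
`W → V ⊗ W`. -/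
def Splits : Label → Label → Label → Prop
  | .plus, b, c => (b = .plus ∧ c = .minus) ∨ (b = .minus ∧ c = .plus)
  | .minus, b, c => b = .minus ∧ c = .minus
  | .w, b, c => (b = .w ∧ c = .minus) ∨ (b = .minus ∧ c = .w)

/-- The tensor-product basis of the space attached to the smoothing `s`: the tensor product of one
factor `V` for each circle and one factor `W` for each arc. -/
abbrev Labelling (T : TangleDiagram) (s : T.State) : Type :=
  {l : T.Component s → Label // ∀ x, l x = .w ↔ Component.IsArc x}

/-- The basis vectors of the Khovanov complex. -/
abbrev Generator (T : TangleDiagram) : Type := Σ s : T.State, T.Labelling s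

/-- The label of the component through a dart. -/
def Generator.labelAt {T : TangleDiagram} (g : T.Generator) (d : T.D) : Label :=
  g.2.1 (T.componentOf g.1 d)

/-- The degree `θ` of a basis vector: the sum of the degrees of its tensor factors. -/
noncomputable def Generator.theta {T : TangleDiagram} (g : T.Generator) : ℤ :=
  ∑ᶠ x : T.Component g.1, (g.2.1 x).degree

/-- The homological degree `k = ℓ(s) - n₋`. -/
noncomputable def homDegree {T : TangleDiagram} (o : T.Orientation) (g : T.Generator) : ℤ :=
  (State.height g.1 : ℤ) - o.nNeg

/-- The quantum degree `Φ = k + n₊ - n₋ + θ`. -/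
noncomputable def quantumDegree {T : TangleDiagram} (o : T.Orientation) (g : T.Generator) : ℤ :=
  homDegree o g + o.nPos - o.nNeg + g.theta

/-- The two pieces of the smoothing `s` at the crossing `c` lie on the same component. (In either
smoothing the positions `0` and `2` lie on different pieces.) -/
def SameAt (T : TangleDiagram) (s : T.State) (c : Fin T.numCrossings) : Prop :=
  T.componentOf s (Sum.inl (c, 0)) = T.componentOf s (Sum.inl (c, 2))

/-- `Occurs g h c`: the basis vector `h` occurs in the image of `g` under the map of the saddle at
the crossing `c`. The saddle changes the `0`-smoothing at `c` into the `1`-smoothing. It is the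
identity on components not involved; it acts by the above maps if it merges two components or splits
one. A saddle between two arcs, which produces again two arcs, acts by zero. -/
def Occurs {T : TangleDiagram} (g h : T.Generator) (c : Fin T.numCrossings) : Prop :=
  g.1 c = false ∧ h.1 = Function.update g.1 c true ∧
  (∀ d : T.D, T.componentOf g.1 d ≠ T.componentOf g.1 (Sum.inl (c, 0)) →
    T.componentOf g.1 d ≠ T.componentOf g.1 (Sum.inl (c, 2)) → h.labelAt d = g.labelAt d) ∧
  ((¬ T.SameAt g.1 c ∧ T.SameAt h.1 c ∧
      Merges (g.labelAt (Sum.inl (c, 0))) (g.labelAt (Sum.inl (c, 2)))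
        (h.labelAt (Sum.inl (c, 0)))) ∨
    (T.SameAt g.1 c ∧ ¬ T.SameAt h.1 c ∧
      Splits (g.labelAt (Sum.inl (c, 0))) (h.labelAt (Sum.inl (c, 0)))
        (h.labelAt (Sum.inl (c, 2)))))

open Classical in
/-- The coefficient of `h` in the differential of `g`. The map of the edge of the cube which changes
the coordinate `c` carries the sign given by the number of `1`-smoothings at crossings before `c`. -/
noncomputable def diffCoeff (K : Type*) [Field K] {T : TangleDiagram} (g h : T.Generator) : K :=
  ∑ c : Fin T.numCrossings,
    if Occurs g h c then (-1) ^ (Finset.univ.filter (fun j => j < c ∧ g.1 j = true)).card else 0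

/-- The basis vectors of homological degree `k` and quantum degree `q`. -/
abbrev GeneratorOf {T : TangleDiagram} (o : T.Orientation) (k q : ℤ) : Type :=
  {g : T.Generator // homDegree o g = k ∧ quantumDegree o g = q}

noncomputable instance (T : TangleDiagram) (s : T.State) : Fintype (T.Component s) :=
  Fintype.ofFinite _

instance : Finite Label :=
  Finite.of_injective (fun l : Label => (decide (l = .plus), decide (l = .minus))) (by
    intro a b h
    cases a <;> cases b <;> simp_all)

noncomputable instance (T : TangleDiagram) : Fintype T.Generator := Fintype.ofFinite _

noncomputable instance {T : TangleDiagram} (o : T.Orientation) (k q : ℤ) :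
    Fintype (GeneratorOf o k q) := Fintype.ofFinite _

/-- The space `C^{k,q}` of the Khovanov complex, in coordinates with respect to its basis. -/
abbrev Chain (K : Type*) [Field K] {T : TangleDiagram} (o : T.Orientation) (k q : ℤ) : Type _ :=
  GeneratorOf o k q → K

/-- The differential `C^{k,q} → C^{k',q}`, for `k' = k + 1`. (It is the zero map for other `k'`.) -/
noncomputable def differential (K : Type*) [Field K] {T : TangleDiagram} (o : T.Orientation)
    (k k' q : ℤ) : Chain K o k q →ₗ[K] Chain K o k' q :=
  Matrix.mulVecLin (Matrix.of fun h g => diffCoeff K g.1 h.1)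

/-- The Khovanov cohomology `H^{k,q}`: the kernel of `C^{k,q} → C^{k+1,q}` modulo the image of
`C^{k-1,q} → C^{k,q}`. -/
abbrev Khovanov (K : Type*) [Field K] {T : TangleDiagram} (o : T.Orientation) (k q : ℤ) : Type _ :=
  LinearMap.ker (differential K o k (k + 1) q) ⧸
    (LinearMap.range (differential K o (k - 1) k q)).submoduleOf
      (LinearMap.ker (differential K o k (k + 1) q))

/-- Only finitely many of the `H^{k,q}` are nonzero. -/
theorem finite_support_khovanov (K : Type*) [Field K] {T : TangleDiagram} (o : T.Orientation) :
    (Function.support fun p : ℤ × ℤ =>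
      (Module.finrank K (Khovanov K o p.1 p.2) : ℤ)).Finite := by
  refine (Set.finite_range fun g : T.Generator => (homDegree o g, quantumDegree o g)).subset ?_
  intro p hp
  by_contra hne
  have : IsEmpty (GeneratorOf o p.1 p.2) := ⟨fun g => hne ⟨g.1, Prod.ext g.2.1 g.2.2⟩⟩
  apply hp
  have : Subsingleton (Khovanov K o p.1 p.2) :=
    (Submodule.Quotient.mk_surjective _).subsingleton
  simp [Module.finrank_zero_of_subsingleton]

/-- The Laurent monomial `x ^ i * y ^ j` in two variables, with integer coefficients. -/
noncomputable def monomial (i j : ℤ) : AddMonoidAlgebra ℤ (ℤ × ℤ) :=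
  AddMonoidAlgebra.single (i, j) 1

/-- The Poincaré polynomial `∑ (dim H^{k,q}) x ^ k y ^ q`, a Laurent polynomial. -/
noncomputable def poincare (K : Type*) [Field K] {T : TangleDiagram} (o : T.Orientation) :
    AddMonoidAlgebra ℤ (ℤ × ℤ) :=
  AddMonoidAlgebra.ofCoeff (Finsupp.ofSupportFinite
    (fun p : ℤ × ℤ => (Module.finrank K (Khovanov K o p.1 p.2) : ℤ)) (finite_support_khovanov K o))

end TangleDiagram

/-! ### Orbits of a group given by generators -/

section PermOrbits

variable {D : Type}

/-! A smoothing of a simple diagram contains no circle (`IsSimple.isArc`). The darts on a circle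
form a mod 2 cycle in the planar graph. Since the first homology of the sphere vanishes
(`exists_face_function`), this cycle is the boundary of a 2-colouring of the faces. The circle
misses the endpoints, so the colour does not change between neighbouring faces along the boundary
circle, and all faces reaching the boundary have one colour. By purity every edge has such faces on
both sides, so the cycle is zero, a contradiction.

Hence every smoothing consists of `N` arcs, because an arc has exactly two endpoints
(`two_mul_card_permOrbits`). Each vertex of the cube carries one generator, of degree `θ = -N`, and
every saddle turns two arcs into two arcs, so the differential vanishes. The Poincaré polynomial is
therefore a sum over the cube, which factors over the crossings. -/

theorem permOrbit_apply {S : Set (Equiv.Perm D)} {g : Equiv.Perm D} (hg : g ∈ S) (d : D) :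
    permOrbit S (g d) = permOrbit S d :=
  Quotient.sound (s := MulAction.orbitRel (Subgroup.closure S) D)
    ⟨⟨g, Subgroup.subset_closure hg⟩, rfl⟩

theorem permOrbit_pow_apply {S : Set (Equiv.Perm D)} {g : Equiv.Perm D} (hg : g ∈ S) (k : ℕ)
    (d : D) : permOrbit S ((g ^ k) d) = permOrbit S d :=
  Quotient.sound (s := MulAction.orbitRel (Subgroup.closure S) D)
    ⟨⟨g ^ k, Subgroup.pow_mem _ (Subgroup.subset_closure hg) k⟩, rfl⟩

/-- A predicate preserved by the generators and their inverses holds on the whole orbit. -/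
theorem permOrbit_induction {S : Set (Equiv.Perm D)} {P : D → Prop}
    (hP : ∀ g ∈ S, ∀ d, P (g d) ↔ P d) {d e : D} (h : permOrbit S d = permOrbit S e) :
    P d ↔ P e := by
  obtain ⟨⟨g, hg⟩, rfl⟩ := Quotient.exact h
  change P (g e) ↔ P e
  clear h
  induction hg using Subgroup.closure_induction generalizing e with
  | mem x hx => exact hP x hx e
  | one => rfl
  | mul x y _ _ hx hy => exact (hx (e := y e)).trans hy
  | inv x _ hx => simpa using (hx (e := x⁻¹ e)).symm

theorem eq_of_permOrbit_eq {S : Set (Equiv.Perm D)} {X : Type*} {f : D → X}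
    (hf : ∀ g ∈ S, ∀ d, f (g d) = f d) {d e : D} (h : permOrbit S d = permOrbit S e) :
    f d = f e :=
  (permOrbit_induction (P := fun x => f x = f e) (fun g hg x => by rw [hf g hg x]) h).2 rfl

theorem permOrbit_singleton_involution {α : Equiv.Perm D} (hα : ∀ d, α (α d) = d) {d e : D} :
    permOrbit {α} d = permOrbit {α} e ↔ d = e ∨ d = α e := by
  constructor
  · intro h
    refine (permOrbit_induction (P := fun x => x = e ∨ x = α e) ?_ h).2 (Or.inl rfl)
    rintro g rfl x
    constructor
    · rintro (h | h)
      · exact Or.inr (by rw [← h, hα])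
      · exact Or.inl (g.injective h)
    · rintro (rfl | rfl)
      · exact Or.inr rfl
      · exact Or.inl (hα _)
  · rintro (rfl | rfl)
    · rfl
    · exact permOrbit_apply (Set.mem_singleton _) e

end PermOrbits

/-! ### Mod 2 homology of a spherical map -/

section Homology

variable {D : Type} [Fintype D]

open Classical in
/-- The incidence matrix of the orbits of two sets of permutations, modulo two. -/
noncomputable def incidenceMatrix (S S' : Set (Equiv.Perm D)) :
    Matrix (PermOrbits S) (PermOrbits S') (ZMod 2) :=
  Matrix.of fun v e => ∑ d : D, if permOrbit S d = v ∧ permOrbit S' d = e then 1 else 0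

noncomputable instance (S : Set (Equiv.Perm D)) : Fintype (PermOrbits S) := Fintype.ofFinite _

theorem incidenceMatrix_transpose (S S' : Set (Equiv.Perm D)) :
    (incidenceMatrix S S').transpose = incidenceMatrix S' S := by
  ext e v
  simp only [incidenceMatrix, Matrix.transpose_apply, Matrix.of_apply]
  exact Finset.sum_congr rfl fun d _ => by congr 1; exact propext and_comm

open Classical in
theorem incidenceMatrix_mulVec (S S' : Set (Equiv.Perm D)) (u : PermOrbits S' → ZMod 2)
    (v : PermOrbits S) :
    (incidenceMatrix S S').mulVec u v
      = ∑ d ∈ Finset.univ.filter (fun d => permOrbit S d = v), u (permOrbit S' d) := by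
  simp only [Matrix.mulVec, dotProduct, incidenceMatrix, Matrix.of_apply, Finset.sum_mul]
  rw [Finset.sum_comm, Finset.sum_filter]
  refine Finset.sum_congr rfl fun d _ => ?_
  by_cases h : permOrbit S d = v <;> simp [h]

theorem incidenceMatrix_mulVec_edge {α : Equiv.Perm D} (hα : ∀ d, α (α d) = d)
    (hne : ∀ d, α d ≠ d) (S : Set (Equiv.Perm D)) (u : PermOrbits S → ZMod 2) (d : D) :
    (incidenceMatrix {α} S).mulVec u (permOrbit {α} d)
      = u (permOrbit S d) + u (permOrbit S (α d)) := by
  classical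
  rw [incidenceMatrix_mulVec, ← Finset.sum_pair (f := fun d => u (permOrbit S d)) (hne d).symm]
  refine Finset.sum_congr ?_ fun _ _ => rfl
  ext e
  simp [permOrbit_singleton_involution hα]

/-- The kernel of a coboundary map has dimension at most the number of components. -/
theorem finrank_ker_incidenceMatrix_le {α σ : Equiv.Perm D} (hα : ∀ d, α (α d) = d)
    (hne : ∀ d, α d ≠ d) (S : Set (Equiv.Perm D))
    (hS : ∀ d, permOrbit S (σ d) = permOrbit S d ∨ permOrbit S (σ d) = permOrbit S (α d)) :
    Module.finrank (ZMod 2) (LinearMap.ker (incidenceMatrix {α} S).mulVecLin)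
      ≤ Nat.card (PermOrbits {σ, α}) := by
  -- Evaluation at one dart of each component. A function in the kernel takes equal values on the
  -- two sides of every edge, so it is constant on components and is determined by these values.
  let φ : (PermOrbits S → ZMod 2) →ₗ[ZMod 2] (PermOrbits {σ, α} → ZMod 2) :=
    LinearMap.funLeft (ZMod 2) (ZMod 2) (fun c => permOrbit S c.out)
  have hinj : Function.Injective
      (φ.comp (LinearMap.ker (incidenceMatrix {α} S).mulVecLin).subtype) := by
    rw [injective_iff_map_eq_zero]
    rintro ⟨u, hu⟩ h
    have hinv : ∀ d, u (permOrbit S (α d)) = u (permOrbit S d) := fun d => by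
      have := incidenceMatrix_mulVec_edge hα hne S u d
      rw [show (incidenceMatrix {α} S).mulVec u = 0 from hu] at this
      exact (CharTwo.add_eq_zero.1 this.symm).symm
    ext x
    induction x using Quotient.inductionOn with
    | h d =>
      have h0 : u (permOrbit S (permOrbit {σ, α} d).out) = 0 := congrFun h (permOrbit {σ, α} d)
      have h1 : permOrbit {σ, α} (permOrbit {σ, α} d).out = permOrbit {σ, α} d :=
        Quotient.out_eq _
      refine (eq_of_permOrbit_eq (f := fun d => u (permOrbit S d)) ?_ h1).symm.trans h0
      rintro g (rfl | rfl) e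
      · rcases hS e with h | h
        · exact congrArg u h
        · exact (congrArg u h).trans (hinv e)
      · exact hinv e
  simpa using LinearMap.finrank_le_finrank_of_injective hinj

/-- The boundary of a boundary is zero: the face to the right of `α d` is also the face to the right
of `σ d`, so the two contributions at a vertex are permuted into each other by the rotation `σ` and
cancel modulo two. -/
theorem incidenceMatrix_mul_eq_zero {α σ : Equiv.Perm D} (hα : ∀ d, α (α d) = d)
    (hne : ∀ d, α d ≠ d) :
    incidenceMatrix {σ} {α} * incidenceMatrix {α} {σ * α} = 0 := by
  classical
  rw [← Matrix.toLin'.injective.eq_iff]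
  refine LinearMap.ext fun u => funext fun v => ?_
  simp only [Matrix.toLin'_apply, map_zero, LinearMap.zero_apply, Pi.zero_apply,
    ← Matrix.mulVec_mulVec]
  rw [incidenceMatrix_mulVec]
  simp only [incidenceMatrix_mulVec_edge hα hne, Finset.sum_add_distrib]
  rw [CharTwo.add_eq_zero]
  symm
  refine Finset.sum_bij (fun d _ => σ d) ?_ (fun _ _ _ _ h => σ.injective h) ?_ ?_
  · intro d hd
    simpa [permOrbit_apply (Set.mem_singleton σ)] using hd
  · intro d hd
    refine ⟨σ.symm d, ?_, by simp⟩
    have := permOrbit_apply (Set.mem_singleton σ) (σ.symm d)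
    simp only [Equiv.apply_symm_apply] at this
    simpa [← this] using hd
  · intro d _
    have := permOrbit_apply (Set.mem_singleton (σ * α)) (α d)
    rw [Equiv.Perm.mul_apply, hα] at this
    rw [this]

/-- The first homology modulo two of a spherical map vanishes: a cycle is a sum of faces. -/
theorem exists_face_function {α σ : Equiv.Perm D} (hα : ∀ d, α (α d) = d)
    (hne : ∀ d, α d ≠ d) (hsph : IsSphericalMap σ α) (z : D → ZMod 2)
    (hz : ∀ d, z (α d) = z d)
    (hcycle : ∀ v, (∑ᶠ d ∈ {d | permOrbit {σ} d = v}, z d) = 0) :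
    ∃ f : PermOrbits {σ * α} → ZMod 2,
      ∀ d, z d = f (permOrbit {σ * α} d) + f (permOrbit {σ * α} (α d)) := by
  classical
  have h1 := finrank_ker_incidenceMatrix_le (σ := σ) hα hne {σ}
    fun d => Or.inl (permOrbit_apply (Set.mem_singleton _) d)
  -- The darts `α d` and `σ d = (σ * α) (α d)` lie on the same face.
  have h2 := finrank_ker_incidenceMatrix_le (σ := σ) hα hne {σ * α} fun d => Or.inr (by
    have := permOrbit_apply (Set.mem_singleton (σ * α)) (α d)
    rwa [Equiv.Perm.mul_apply, hα] at this)
  set M := incidenceMatrix {σ} {α}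
  set N := incidenceMatrix {α} {σ * α}
  have hle : LinearMap.range N.mulVecLin ≤ LinearMap.ker M.mulVecLin := by
    rintro _ ⟨u, rfl⟩
    rw [LinearMap.mem_ker, Matrix.mulVecLin_apply, Matrix.mulVecLin_apply, Matrix.mulVec_mulVec,
      incidenceMatrix_mul_eq_zero hα hne, Matrix.zero_mulVec]
  have r1 := LinearMap.finrank_range_add_finrank_ker M.mulVecLin
  have r2 := LinearMap.finrank_range_add_finrank_ker N.mulVecLin
  have r3 := LinearMap.finrank_range_add_finrank_ker (incidenceMatrix {α} {σ}).mulVecLin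
  have r4 : Module.finrank (ZMod 2) (LinearMap.range (incidenceMatrix {α} {σ}).mulVecLin)
      = Module.finrank (ZMod 2) (LinearMap.range M.mulVecLin) := by
    rw [← incidenceMatrix_transpose]
    exact Matrix.rank_transpose M
  simp only [Module.finrank_fintype_fun_eq_card, ← Nat.card_eq_fintype_card] at r1 r2 r3
  -- With `V`, `E`, `F`, `C` the numbers of vertices, edges, faces and components: `dim ker M = E -
  -- rank M ≤ E - V + C = F - C ≤ rank N`, where the middle equality is Euler's formula and `rank M`
  -- is computed from the transpose.
  have heq := Submodule.eq_of_le_of_finrank_le hle (by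
    unfold IsSphericalMap at hsph
    omega)
  let g : PermOrbits {α} → ZMod 2 := fun e => z e.out
  have hg : ∀ d, g (permOrbit {α} d) = z d := fun d =>
    eq_of_permOrbit_eq (f := z) (by rintro _ rfl; exact hz) (Quotient.out_eq _)
  have hgM : g ∈ LinearMap.ker M.mulVecLin := by
    rw [LinearMap.mem_ker, Matrix.mulVecLin_apply]
    funext v
    rw [incidenceMatrix_mulVec, Pi.zero_apply, ← hcycle v, finsum_mem_eq_sum_of_inter_support_eq]
    · exact Finset.sum_congr rfl fun d _ => hg d
    · ext; simp
  rw [← heq] at hgM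
  obtain ⟨f, hf⟩ := hgM
  exact ⟨f, fun d => by
    rw [← hg, ← hf, Matrix.mulVecLin_apply, incidenceMatrix_mulVec_edge hα hne]⟩

end Homology

/-! ### Orbits of two involutions -/

section Involutions

variable {D : Type} [Finite D]

/-- An orbit of two involutions, the first without fixed points, has exactly two fixed points of
the second as soon as it has one. -/
theorem exists_unique_other_fixed {α β : Equiv.Perm D} (hα : ∀ d, α (α d) = d)
    (hne : ∀ d, α d ≠ d) (hβ : ∀ d, β (β d) = d) {p : D} (hp : β p = p) :
    ∃ q, q ≠ p ∧ β q = q ∧ permOrbit {α, β} q = permOrbit {α, β} p ∧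
      ∀ d, β d = d → permOrbit {α, β} d = permOrbit {α, β} p → d = p ∨ d = q := by
  -- The orbit of `p` is dihedral: it consists of the points `τ ^ k p`, on which `β` acts by `k ↦
  -- -k` and `α` by `k ↦ 1 - k`.
  set τ := α * β with hτ
  have hαα : α * α = 1 := Equiv.ext hα
  have hββ : β * β = 1 := Equiv.ext hβ
  have hβi : β⁻¹ = β := inv_eq_of_mul_eq_one_left hββ
  have hαi : α⁻¹ = α := inv_eq_of_mul_eq_one_left hαα
  have hconj : β * τ * β⁻¹ = τ⁻¹ := by
    rw [hτ, mul_inv_rev, hαi, hβi, mul_assoc, mul_assoc, hββ, mul_one]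
  have hβτ : ∀ k : ℤ, β ((τ ^ k) p) = (τ ^ (-k)) p := fun k => by
    have : (β * τ * β⁻¹) ^ k = (τ⁻¹) ^ k := by rw [hconj]
    rw [conj_zpow, inv_zpow', hβi] at this
    rw [← this, Equiv.Perm.mul_apply, Equiv.Perm.mul_apply, hp]
  have hατ : ∀ k : ℤ, α ((τ ^ k) p) = (τ ^ (1 - k)) p := fun k => by
    rw [sub_eq_add_neg, zpow_add, zpow_one, Equiv.Perm.mul_apply, ← hβτ, hτ, Equiv.Perm.mul_apply,
      hβ]
  have horb : ∀ d, permOrbit {α, β} d = permOrbit {α, β} p ↔ ∃ k : ℤ, d = (τ ^ k) p := fun d => by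
    constructor
    · intro h
      refine (permOrbit_induction (P := fun d => ∃ k : ℤ, d = (τ ^ k) p) ?_ h).2 ⟨0, rfl⟩
      have key : ∀ g ∈ ({α, β} : Set (Equiv.Perm D)), ∀ d, (∃ k : ℤ, d = (τ ^ k) p) →
          ∃ k : ℤ, g d = (τ ^ k) p := by
        rintro g (rfl | rfl) _ ⟨k, rfl⟩
        · exact ⟨_, hατ k⟩
        · exact ⟨_, hβτ k⟩
      intro g hg d
      refine ⟨fun h => ?_, key g hg d⟩
      have := key g hg _ h
      rcases hg with rfl | rfl
      · rwa [hα] at this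
      · rwa [hβ] at this
    · rintro ⟨k, rfl⟩
      refine Quotient.sound (s := MulAction.orbitRel _ D) ⟨⟨τ ^ k, Subgroup.zpow_mem _ ?_ k⟩, rfl⟩
      exact Subgroup.mul_mem _ (Subgroup.subset_closure (by simp))
        (Subgroup.subset_closure (by simp))
  have hper : ∀ k l : ℤ, (τ ^ k) p = (τ ^ l) p ↔
      (Function.minimalPeriod (τ • ·) p : ℤ) ∣ k - l := fun k l => by
    rw [← MulAction.zpow_smul_eq_iff_minimalPeriod_dvd, Equiv.Perm.smul_def, sub_eq_neg_add,
      zpow_add, Equiv.Perm.mul_apply, zpow_neg, Equiv.Perm.inv_eq_iff_eq]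
  have hpos : 0 < Function.minimalPeriod (τ • ·) p :=
    Function.minimalPeriod_pos_of_mem_periodicPts
      (Function.Injective.mem_periodicPts τ.injective p)
  set m := Function.minimalPeriod (τ • ·) p
  rcases Nat.even_or_odd' m with ⟨r, hr | hr⟩
  -- For period `2 * r`, the point `τ ^ k p` is fixed by `β` iff `2 * r` divides `2 * k`, that is,
  -- iff `k` is `0` or `r` modulo the period.
  · have hr0 : 0 < r := by omega
    refine ⟨(τ ^ (r : ℤ)) p, ?_, ?_, (horb _).2 ⟨r, rfl⟩, ?_⟩
    · intro h
      have := (hper r 0).1 h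
      have := Int.le_of_dvd (by omega) this
      omega
    · rw [hβτ, hper]
      exact ⟨-1, by push_cast [hr]; ring⟩
    · intro d hd h
      obtain ⟨k, rfl⟩ := (horb d).1 h
      rw [hβτ, hper] at hd
      obtain ⟨j, hj⟩ := hd
      have hk : k = r * (-j) := by
        have : (2 : ℤ) * k = 2 * (r * (-j)) := by
          rw [hr] at hj; push_cast at hj; linarith
        linarith
      rcases Int.even_or_odd' (-j) with ⟨i, hi | hi⟩
      · left
        refine (hper k 0).2 ⟨i, ?_⟩
        rw [hk, hi, hr]; push_cast; ring
      · right
        refine (hper k r).2 ⟨i, ?_⟩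
        rw [hk, hi, hr]; push_cast; ring
  -- For period `2 * r + 1`, the reflection `k ↦ 1 - k` fixes `k = r + 1`, but `α` has no fixed
  -- point.
  · refine absurd ?_ (hne ((τ ^ ((r : ℤ) + 1)) p))
    rw [hατ, hper]
    exact ⟨-1, by push_cast [hr]; ring⟩

/-- Each orbit contains exactly two fixed points of `β`. This counts strands by their endpoints,
both in the diagram itself and in its smoothings. -/
theorem two_mul_card_permOrbits {α β : Equiv.Perm D} (hα : ∀ d, α (α d) = d)
    (hne : ∀ d, α d ≠ d) (hβ : ∀ d, β (β d) = d)
    (hfix : ∀ d, ∃ p, β p = p ∧ permOrbit {α, β} d = permOrbit {α, β} p) :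
    2 * Nat.card (PermOrbits {α, β}) = Nat.card {p // β p = p} := by
  classical
  have := Fintype.ofFinite D
  have := Fintype.ofFinite (PermOrbits {α, β})
  rw [Nat.card_eq_fintype_card, Nat.card_eq_fintype_card, Fintype.card_subtype,
    Finset.card_eq_sum_card_fiberwise (f := permOrbit {α, β}) (t := Finset.univ) (by simp),
    Finset.sum_const_nat (m := 2), mul_comm, Finset.card_univ]
  intro x _
  induction x using Quotient.inductionOn with
  | h d =>
    obtain ⟨p, hp, hdp⟩ := hfix d
    obtain ⟨q, hqp, hq, hqo, huniq⟩ := exists_unique_other_fixed hα hne hβ hp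
    rw [Finset.card_eq_two]
    refine ⟨p, q, hqp.symm, ?_⟩
    ext e
    simp only [Finset.mem_filter, Finset.mem_univ, true_and, Finset.mem_insert,
      Finset.mem_singleton]
    change _ ∧ permOrbit {α, β} e = permOrbit {α, β} d ↔ _
    rw [hdp]
    constructor
    · exact fun h => huniq e h.1 h.2
    · rintro (rfl | rfl)
      · exact ⟨hp, rfl⟩
      · exact ⟨hq, hqo⟩

end Involutions

/-! ### Smoothings of a simple diagram -/

namespace TangleDiagram

variable {T : TangleDiagram}

theorem finRotate_const {b : ℕ} {X : Type*} {f : Fin b → X} (hf : ∀ p, f (finRotate b p) = f p)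
    (p q : Fin b) : f p = f q := by
  cases b with
  | zero => exact p.elim0
  | succ b =>
    have h : ∀ r : Fin (b + 1), f r = f 0 := fun r => by
      induction r using Fin.induction with
      | zero => rfl
      | succ i ih =>
        rw [← ih, ← hf i.castSucc, finRotate_apply, Fin.coeSucc_eq_succ]
    rw [h p, h q]

theorem permOrbit_rotation_inl {n b : ℕ} (c : Fin n) (i j : Fin 4) :
    permOrbit {rotation n b} (Sum.inl (c, i)) = permOrbit {rotation n b} (Sum.inl (c, j)) := by
  have h : ∀ i : Fin 4, permOrbit {rotation n b} (Sum.inl (c, i))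
      = permOrbit {rotation n b} (Sum.inl (c, 0)) := fun i => by
    have := permOrbit_pow_apply (Set.mem_singleton (rotation n b)) i (Sum.inl (c, 0))
    rw [← this]
    fin_cases i <;> rfl
  rw [h i, h j]

theorem smoothing_smoothing (s : T.State) (d : T.D) : T.smoothing s (T.smoothing s d) = d := by
  rcases d with ⟨c, i⟩ | p
  · simp only [smoothing, dartPerm, Equiv.sumCongr_apply, Sum.map_inl, Equiv.prodCongrRight_apply]
    cases s c <;> fin_cases i <;> rfl
  · rfl

theorem smoothing_eq_self (s : T.State) (d : T.D) :
    T.smoothing s d = d ↔ ∃ p, d = Sum.inr p := by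
  rcases d with ⟨c, i⟩ | p
  · simp only [smoothing, dartPerm, Equiv.sumCongr_apply, Sum.map_inl, Equiv.prodCongrRight_apply,
      reduceCtorEq, exists_false, iff_false, Sum.inl.injEq, Prod.mk.injEq, true_and]
    cases s c <;> fin_cases i <;> decide
  · simp [smoothing, dartPerm]

theorem straight_straight {n b : ℕ} (d : Dart n b) : straight n b (straight n b d) = d := by
  rcases d with ⟨c, i⟩ | p
  · fin_cases i <;> rfl
  · rfl

theorem straight_eq_self {n b : ℕ} (d : Dart n b) :
    straight n b d = d ↔ ∃ p, d = Sum.inr p := by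
  rcases d with ⟨c, i⟩ | p
  · simp only [straight, dartPerm, Equiv.sumCongr_apply, Sum.map_inl, Equiv.prodCongrRight_apply,
      reduceCtorEq, exists_false, iff_false, Sum.inl.injEq, Prod.mk.injEq, true_and]
    fin_cases i <;> decide
  · simp [straight, dartPerm]

theorem permOrbit_rotation_smoothing (s : T.State) (d : T.D) :
    permOrbit {rotation T.numCrossings T.numEndpoints} (T.smoothing s d)
      = permOrbit {rotation T.numCrossings T.numEndpoints} d := by
  rcases d with ⟨c, i⟩ | p
  · exact permOrbit_rotation_inl c _ i
  · rfl

theorem componentOf_edge (s : T.State) (d : T.D) :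
    T.componentOf s (T.edge d) = T.componentOf s d := permOrbit_apply (by simp) d

theorem componentOf_smoothing (s : T.State) (d : T.D) :
    T.componentOf s (T.smoothing s d) = T.componentOf s d := permOrbit_apply (by simp) d

/-- The smoothings of a simple tangle diagram have no circles. -/
theorem IsSimple.isArc (hT : T.IsSimple) {s : T.State} (x : T.Component s) :
    Component.IsArc x := by
  classical
  by_contra hx
  let z : T.D → ZMod 2 := fun d => if T.componentOf s d = x then 1 else 0
  have hz : ∀ d, z (T.edge d) = z d := fun d => by simp only [z, componentOf_edge]
  have hzs : ∀ d, z (T.smoothing s d) = z d := fun d => by simp only [z, componentOf_smoothing]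
  have hz0 : ∀ p, z (Sum.inr p) = 0 := fun p => if_neg fun h => hx ⟨p, h.symm⟩
  -- `z` is a cycle: at each vertex the smoothing pairs darts with equal values of `z`, and the
  -- unpaired darts are endpoints, where `z` vanishes.
  obtain ⟨f, hf⟩ := exists_face_function T.edge_edge T.edge_ne T.planar z hz fun v => by
    rw [finsum_mem_eq_finite_toFinset_sum _ (Set.toFinite _)]
    refine Finset.sum_involution (fun d _ => T.smoothing s d) ?_ ?_ ?_ ?_
    · exact fun d _ => by rw [hzs, CharTwo.add_self_eq_zero]
    · rintro d _ hd h
      obtain ⟨p, rfl⟩ := (smoothing_eq_self s d).1 h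
      exact hd (hz0 p)
    · intro d hd
      simpa [permOrbit_rotation_smoothing] using hd
    · exact fun d _ => smoothing_smoothing s d
  -- The edge at an endpoint separates the faces at the two adjacent pieces of the boundary circle,
  -- and `z` vanishes on it.
  have hcorner : ∀ p, f (T.rightFace (Sum.inr (finRotate _ p))) = f (T.rightFace (Sum.inr p)) := by
    intro p
    have h := hf (Sum.inr p)
    rw [hz0] at h
    rw [CharTwo.add_eq_zero.1 h.symm]
    have := permOrbit_apply (Set.mem_singleton (rotation T.numCrossings T.numEndpoints * T.edge))
      (T.edge (Sum.inr p))
    rw [Equiv.Perm.mul_apply, T.edge_edge] at this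
    exact congrArg f this
  induction x using Quotient.inductionOn with
  | h d =>
    -- Purity places both sides of this edge of the circle in faces that reach the boundary, where
    -- `f` is constant.
    obtain ⟨⟨p, hp⟩, ⟨q, hq⟩⟩ := hT (T.arcOf d) d rfl
    have h1 : z d = 1 := if_pos rfl
    have h2 := hf d
    rw [show permOrbit _ d = _ from hp, show permOrbit _ (T.edge d) = _ from hq, h1,
      finRotate_const (f := fun p => f (T.rightFace (Sum.inr p))) hcorner p q,
      CharTwo.add_self_eq_zero] at h2
    exact one_ne_zero h2

theorem card_endpoints {β : Equiv.Perm T.D} (hβ : ∀ d, β d = d ↔ ∃ p, d = Sum.inr p) :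
    Nat.card {d // β d = d} = T.numEndpoints := by
  rw [← Nat.card_fin T.numEndpoints]
  refine (Nat.card_congr (Equiv.ofBijective (fun p => ⟨Sum.inr p, (hβ _).2 ⟨p, rfl⟩⟩) ⟨?_, ?_⟩)).symm
  · exact fun p q h => Sum.inr.inj (congrArg Subtype.val h)
  · rintro ⟨d, hd⟩
    obtain ⟨p, rfl⟩ := (hβ d).1 hd
    exact ⟨p, rfl⟩

theorem two_mul_numArcs (T : TangleDiagram) : 2 * T.numArcs = T.numEndpoints := by
  rw [← card_endpoints straight_eq_self]
  refine two_mul_card_permOrbits T.edge_edge T.edge_ne straight_straight fun d => ?_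
  obtain ⟨p, hp⟩ := T.no_closed d
  exact ⟨_, (straight_eq_self _).2 ⟨p, rfl⟩, hp⟩

theorem IsSimple.card_component (hT : T.IsSimple) (s : T.State) :
    Nat.card (T.Component s) = T.numArcs := by
  have h : 2 * Nat.card (T.Component s) = T.numEndpoints := by
    rw [← card_endpoints (smoothing_eq_self s)]
    refine two_mul_card_permOrbits T.edge_edge T.edge_ne (smoothing_smoothing s) fun d => ?_
    obtain ⟨p, hp⟩ := hT.isArc (T.componentOf s d)
    exact ⟨_, (smoothing_eq_self s _).2 ⟨p, rfl⟩, hp⟩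
  have := T.two_mul_numArcs
  omega

/-! ### The Khovanov complex of a simple diagram -/

theorem IsSimple.label_eq (hT : T.IsSimple) (g : T.Generator) (x : T.Component g.1) :
    g.2.1 x = .w :=
  (g.2.2 x).2 (hT.isArc x)

theorem IsSimple.theta_eq (hT : T.IsSimple) (g : T.Generator) : g.theta = -T.numArcs := by
  rw [← hT.card_component g.1, Generator.theta, finsum_eq_sum_of_fintype]
  simp [hT.label_eq, Label.degree, Nat.card_eq_fintype_card]

/-- Every saddle transforms two arcs into two arcs. -/
theorem IsSimple.not_occurs (hT : T.IsSimple) (g h : T.Generator) (c : Fin T.numCrossings) :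
    ¬ Occurs g h c := by
  rintro ⟨-, -, -, ⟨-, -, hm⟩ | ⟨-, -, hs⟩⟩
  · simp [Generator.labelAt, hT.label_eq, Merges] at hm
  · simp [Generator.labelAt, hT.label_eq, Splits] at hs

theorem IsSimple.differential_eq_zero (K : Type*) [Field K] (hT : T.IsSimple) (o : T.Orientation)
    (k k' q : ℤ) : differential K o k k' q = 0 := by
  refine LinearMap.ext fun v => funext fun h => ?_
  simp [differential, Matrix.mulVec, dotProduct, diffCoeff, hT.not_occurs]

theorem finrank_homology_of_eq_zero {K U V W : Type*} [Field K] [AddCommGroup U] [AddCommGroup V]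
    [AddCommGroup W] [Module K U] [Module K V] [Module K W] [FiniteDimensional K V]
    {f : U →ₗ[K] V} {g : V →ₗ[K] W} (hf : f = 0) (hg : g = 0) :
    Module.finrank K (LinearMap.ker g ⧸ (LinearMap.range f).submoduleOf (LinearMap.ker g))
      = Module.finrank K V := by
  subst hf hg
  have h := Submodule.finrank_quotient_add_finrank
    ((LinearMap.range (0 : U →ₗ[K] V)).submoduleOf (LinearMap.ker (0 : V →ₗ[K] W)))
  have h0 : (LinearMap.range (0 : U →ₗ[K] V)).submoduleOf (LinearMap.ker (0 : V →ₗ[K] W)) = ⊥ := by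
    rw [LinearMap.range_zero, Submodule.submoduleOf, Submodule.comap_bot, Submodule.ker_subtype]
  have hker : Module.finrank K (LinearMap.ker (0 : V →ₗ[K] W)) = Module.finrank K V := by
    rw [LinearMap.ker_zero, finrank_top]
  rwa [hker, (Submodule.finrank_eq_zero).2 h0, add_zero] at h

theorem IsSimple.finrank_khovanov (K : Type*) [Field K] (hT : T.IsSimple) (o : T.Orientation)
    (k q : ℤ) : Module.finrank K (Khovanov K o k q) = Nat.card (GeneratorOf o k q) := by
  rw [finrank_homology_of_eq_zero (hT.differential_eq_zero K o _ _ _)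
    (hT.differential_eq_zero K o _ _ _), Module.finrank_fintype_fun_eq_card,
    Nat.card_eq_fintype_card]

/-- A simple diagram has exactly one generator for each state. -/
noncomputable def IsSimple.generatorEquiv (hT : T.IsSimple) : T.Generator ≃ T.State where
  toFun g := g.1
  invFun s := ⟨s, fun _ => .w, fun x => by simp [hT.isArc x]⟩
  left_inv g := Sigma.ext rfl (heq_of_eq (Subtype.ext (funext fun x => (hT.label_eq g x).symm)))
  right_inv _ := rfl

/-! ### Summation over the cube -/

theorem monomial_mul (i j k l : ℤ) : monomial i j * monomial k l = monomial (i + k) (j + l) := by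
  simp [monomial, AddMonoidAlgebra.single_mul_single]

theorem monomial_pow (i j : ℤ) (n : ℕ) : monomial i j ^ n = monomial (n * i) (n * j) := by
  simp [monomial, AddMonoidAlgebra.single_pow]

theorem IsSimple.poincare_eq_sum (K : Type*) [Field K] (hT : T.IsSimple) (o : T.Orientation) :
    poincare K o = ∑ g : T.Generator, monomial (homDegree o g) (quantumDegree o g) := by
  classical
  ext ⟨k, q⟩
  simp [poincare, monomial, hT.finrank_khovanov K, Finsupp.ofSupportFinite_coe, AddMonoidAlgebra.coeff_sum,
    Finsupp.single_apply, Nat.card_eq_fintype_card, Fintype.card_subtype]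

/-- Expanding the product, each crossing chooses either `1` or `xy`, according to its smoothing. -/
theorem sum_monomial_height (T : TangleDiagram) :
    ∑ s : T.State, monomial s.height s.height = (1 + monomial 1 1) ^ T.numCrossings := by
  have h := Finset.prod_univ_sum (fun _ : Fin T.numCrossings => (Finset.univ : Finset Bool))
    (fun _ b => if b then monomial 1 1 else 1)
  simp only [Fintype.sum_bool, Finset.prod_const, Finset.card_univ, Fintype.card_fin,
    Fintype.piFinset_univ] at h
  simp only [if_true, Bool.false_eq_true, if_false] at h
  rw [add_comm, h]
  refine Finset.sum_congr rfl fun s _ => ?_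
  rw [Finset.prod_ite, Finset.prod_const, Finset.prod_const_one, mul_one, monomial_pow, mul_one]
  rfl

theorem Orientation.nPos_add_nNeg (o : T.Orientation) : o.nPos + o.nNeg = T.numCrossings := by
  classical
  rw [Orientation.nPos, Orientation.nNeg, Nat.card_eq_fintype_card, Nat.card_eq_fintype_card,
    Fintype.card_subtype_compl, Fintype.card_fin]
  have := Fintype.card_subtype_le o.RightHanded
  rw [Fintype.card_fin] at this
  omega

end TangleDiagram

theorem theorem2p14 (K : Type*) [Field K] (T : TangleDiagram) (o : T.Orientation)
    (hT : T.IsSimple) :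
    TangleDiagram.poincare K o =
      TangleDiagram.monomial 0 (-(T.numArcs : ℤ) + o.nPos + o.nNeg)
        * (1 + TangleDiagram.monomial 1 1) ^ o.nPos
        * (TangleDiagram.monomial (-1) (-3) + TangleDiagram.monomial 0 (-2)) ^ o.nNeg := by
  open TangleDiagram in
  -- Left-handed crossings contribute the same factor `1 + xy` as right-handed ones, up to a shift
  -- by `x⁻¹y⁻³`.
  have hfactor : monomial (-1) (-3) + monomial 0 (-2)
      = monomial (-1) (-3) * (1 + monomial 1 1) := by
    rw [mul_add, mul_one, monomial_mul]
    norm_num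
  -- Since `θ = -N` is constant, the bidegree depends on the state only through its height, which
  -- enters both degrees equally.
  have hdeg : ∀ s : T.State, monomial (homDegree o (hT.generatorEquiv.symm s))
      (quantumDegree o (hT.generatorEquiv.symm s))
        = monomial (-o.nNeg) (-T.numArcs + o.nPos - 2 * o.nNeg)
          * monomial s.height s.height := fun s => by
    rw [monomial_mul, quantumDegree, hT.theta_eq, homDegree]
    congr 1
    · exact sub_eq_neg_add _ _
    · change (s.height : ℤ) - _ + _ - _ + _ = _
      ring
  rw [hT.poincare_eq_sum K, ← hT.generatorEquiv.symm.sum_comp, Finset.sum_congr rfl fun s _ => hdeg s,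
    ← Finset.mul_sum, sum_monomial_height, hfactor, mul_pow, monomial_pow, ← o.nPos_add_nNeg,
    pow_add, mul_mul_mul_comm, monomial_mul]
  congr 2 <;> ring
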